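/- Let $\mathbb K\in\{\mathbb R,\mathbb C\}$, let $m\ge 2$ be an integer, $\mathbf r=(r_1,\dots,r_m)\in(0,+\infty)^m$, and let $1<p_m\le 2<p_1,\dots,p_{m-1}\le\infty$ satisfy $\frac1{p_1}+\cdots+\frac1{p_m}<1$ (with $1/\infty=0$). For $k=1,\dots,m$ put $$\delta_{m-k+1}^{p_k,\dots,p_m}:=\frac{1}{1-\left(\frac1{p_k}+\cdots+\frac1{p_m}\right)},\qquad s_k:=\max\left\{\frac1{r_k}-\frac1{\delta_{m-k+1}^{p_k,\dots,p_m}},\,0\right\}.$$ Then there is a constant $D\ge 1$, depending only on $\mathbb K,m,\mathbf p,\mathbf r$, such that for all positive integers $n_1,\dots,n_m$ and all bounded $m$-linear forms $T:\ell_{p_1}\times\cdots\times\ell_{p_m}\to\mathbb K$, $$\left(\sum_{i_1=1}^{n_1}\left(\cdots\left(\sum_{i_m=1}^{n_m}\left|T(e_{i_1},\dots,e_{i_m})\right|^{r_m}\right)^{\frac{r_{m-1}}{r_m}}\cdots\right)^{\frac{r_1}{r_2}}\right)^{\frac1{r_1}}\le D\,\|T\|\prod_{k=1}^m n_k^{s_k}.$$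 Moreover, the exponent $s_m$ of $n_m$ is optimal, and for each $k=1,\dots,m-1$ the exponent $s_k$ of $n_k$ is optimal provided that $r_j\ge\delta_{m-j+1}^{p_j,\dots,p_m}$ for all $k+1\le j\le m$. Here optimality of $s_k$ means: if $t_1,\dots,t_m\in\mathbb R$ with $t_j=s_j$ for all $j>k$ (and $t_j$ arbitrary for $j<k$), and if for some constant $C$ the inequality above holds, with $C$ in place of $D$ and $\prod_j n_j^{t_j}$ in place of $\prod_j n_j^{s_j}$, for all positive integers $n_1,\dots,n_m$ and all bounded $m$-linear forms $T$, then $t_k\ge s_k$. -/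

import Mathlib

open scoped ENNReal

noncomputable section

/-- The iterated mixed sum of a scalar array `a` over the box `[n₁] × ⋯ × [nₘ]` (indices start
at `0`), with `i₁` the outermost and `iₘ` the innermost summation index:
`(∑_{i₁} (⋯ (∑_{iₘ} ‖a i‖ ^ rₘ) ^ (rₘ₋₁ / rₘ) ⋯ ) ^ (r₁ / r₂)) ^ (1 / r₁)`. -/
def mixedSum {𝕜 : Type*} [RCLike 𝕜] :
    (m : ℕ) → (Fin m → ℝ) → (Fin m → ℕ) → ((Fin m → ℕ) → 𝕜) → ℝ
  | 0, _, _, a => ‖a Fin.elim0‖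
  | m + 1, r, n, a =>
      (∑ i ∈ Finset.range (n 0),
        mixedSum m (Fin.tail r) (Fin.tail n) (fun v => a (Fin.cons i v)) ^ (r 0)) ^ (1 / r 0)

/-- Bounded `m`-linear forms `T : ℓ_{p₁} × ⋯ × ℓ_{pₘ} → 𝕜`, with the operator norm. -/
abbrev LpForm (𝕜 : Type*) [RCLike 𝕜] {m : ℕ} (p : Fin m → ℝ≥0∞) [∀ j, Fact (1 ≤ p j)] : Type _ :=
  ContinuousMultilinearMap 𝕜 (fun j : Fin m => lp (fun _ : ℕ => 𝕜) (p j)) 𝕜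

/-- The coefficients `T (e_{i₁}, …, e_{iₘ})`. -/
def LpForm.coeff {𝕜 : Type*} [RCLike 𝕜] {m : ℕ} {p : Fin m → ℝ≥0∞} [∀ j, Fact (1 ≤ p j)]
    (T : LpForm 𝕜 p) (i : Fin m → ℕ) : 𝕜 :=
  T (fun j => lp.single (p j) (i j) (1 : 𝕜))

/-- `δ_{m-k+1}^{p_k, …, p_m} = (1 - (1 / p_k + ⋯ + 1 / p_m))⁻¹`, where `1 / ∞ = 0`. -/
def hlDelta {m : ℕ} (p : Fin m → ℝ≥0∞) (k : Fin m) : ℝ :=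
  1 / (1 - ∑ j ∈ Finset.Ici k, 1 / (p j).toReal)

/-- The exponent `max {1 / r_k - 1 / δ_{m-k+1}^{p_k, …, p_m}, 0}` of `n_k`. -/
def hlExponent {m : ℕ} (p : Fin m → ℝ≥0∞) (r : Fin m → ℝ) (k : Fin m) : ℝ :=
  max (1 / r k - 1 / hlDelta p k) 0

/-- The mixed `r`-sum inequality holds with constant `C` and the exponents `t₁, …, tₘ` of
`n₁, …, nₘ`, for all positive integers `n₁, …, nₘ` and all bounded `m`-linear forms. -/
def MixedInequality (𝕜 : Type*) [RCLike 𝕜] {m : ℕ} (p : Fin m → ℝ≥0∞) [∀ j, Fact (1 ≤ p j)]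
    (r t : Fin m → ℝ) (C : ℝ) : Prop :=
  ∀ n : Fin m → ℕ, (∀ j, 0 < n j) → ∀ T : LpForm 𝕜 p,
    mixedSum m r n T.coeff ≤ C * ‖T‖ * ∏ k, (n k : ℝ) ^ t k

/-- The exponent of `n_k` is optimal: if the inequality holds, with any constant, for exponents
that agree with the stated ones at all `j > k` and are arbitrary at all `j < k`, then the exponent
of `n_k` is at least the stated one. -/
def IsOptimalExponent (𝕜 : Type*) [RCLike 𝕜] {m : ℕ} (p : Fin m → ℝ≥0∞) [∀ j, Fact (1 ≤ p j)]
    (r : Fin m → ℝ) (k : Fin m) : Prop :=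
  ∀ (t : Fin m → ℝ) (C : ℝ), (∀ j, k < j → t j = hlExponent p r j) →
    MixedInequality 𝕜 p r t C → hlExponent p r k ≤ t k

end

theorem sum_rpow_le_rpow_sum {ι : Type*} (s : Finset ι) (f : ι → ℝ) (hf : ∀ i, 0 ≤ f i)
    {p : ℝ} (hp : 1 ≤ p) : ∑ i ∈ s, f i ^ p ≤ (∑ i ∈ s, f i) ^ p := by
  classical
  induction s using Finset.induction_on with
  | empty => simp [Real.zero_rpow (by linarith : p ≠ 0)]
  | insert a s ha ih =>
    rw [Finset.sum_insert ha, Finset.sum_insert ha]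
    exact (add_le_add_right ih _).trans
      (Real.add_rpow_le_rpow_add (hf a) (Finset.sum_nonneg fun i _ => hf i) hp)

/-- Comparison of `ℓ_r` and `ℓ_q` quasi-norms on `n` coordinates. -/
theorem rpow_sum_rpow_le_card_rpow_mul (n : ℕ) (f : ℕ → ℝ) (hf : ∀ i, 0 ≤ f i)
    {r q : ℝ} (hr : 0 < r) (hq : 0 < q) :
    (∑ i ∈ Finset.range n, f i ^ r) ^ (1 / r) ≤
      (n : ℝ) ^ max (1 / r - 1 / q) 0 * (∑ i ∈ Finset.range n, f i ^ q) ^ (1 / q) := by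
  have hpow : ∀ {a b : ℝ}, 0 < a → ∀ i, (f i ^ a) ^ (b / a) = f i ^ b := fun {a b} ha i => by
    rw [← Real.rpow_mul (hf i), mul_div_cancel₀ _ ha.ne']
  have hS : ∀ a : ℝ, 0 ≤ ∑ i ∈ Finset.range n, f i ^ a :=
    fun a => Finset.sum_nonneg fun i _ => Real.rpow_nonneg (hf i) _
  rcases le_total q r with h | h
  · have h1 : 1 / r ≤ 1 / q := one_div_le_one_div_of_le hq h
    rw [max_eq_right (by linarith), Real.rpow_zero, one_mul]
    have := sum_rpow_le_rpow_sum (Finset.range n) (fun i => f i ^ q)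
      (fun i => Real.rpow_nonneg (hf i) _) ((one_le_div hq).2 h)
    simp only [hpow hq] at this
    refine (Real.rpow_le_rpow (hS r) this (by positivity)).trans_eq ?_
    rw [← Real.rpow_mul (hS q)]
    congr 1
    field_simp
  · have h1 : 1 / q ≤ 1 / r := one_div_le_one_div_of_le hr h
    rw [max_eq_left (by linarith)]
    have := Real.rpow_sum_le_const_mul_sum_rpow_of_nonneg (Finset.range n)
      (f := fun i => f i ^ r) ((one_le_div hr).2 h) (fun i _ => Real.rpow_nonneg (hf i) _)
    simp only [hpow hr, Finset.card_range] at this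
    have h2 := Real.rpow_le_rpow (Real.rpow_nonneg (hS r) _) this (one_div_nonneg.2 hq.le)
    rw [← Real.rpow_mul (hS r), Real.mul_rpow (by positivity) (hS q),
      ← Real.rpow_mul (by positivity)] at h2
    convert h2 using 2
    · field_simp
    · congr 1
      field_simp

theorem midpoint_rpow_le {x y s : ℝ} (hx : 0 ≤ x) (hy : 0 ≤ y) (hs : 1 ≤ s) :
    ((x + y) / 2) ^ s ≤ (x ^ s + y ^ s) / 2 := by
  have := (convexOn_rpow hs).2 hx hy (by norm_num : (0 : ℝ) ≤ 1 / 2)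
    (by norm_num : (0 : ℝ) ≤ 1 / 2) (by norm_num)
  simp only [smul_eq_mul] at this
  rwa [← mul_add, ← mul_add, one_div_mul_eq_div, one_div_mul_eq_div] at this

section MixedSum

variable {𝕜 : Type*} [RCLike 𝕜]

theorem mixedSum_nonneg (m : ℕ) (r : Fin m → ℝ) (n : Fin m → ℕ) (a : (Fin m → ℕ) → 𝕜) :
    0 ≤ mixedSum m r n a := by
  induction m with
  | zero => exact norm_nonneg _
  | succ m ih =>
    exact Real.rpow_nonneg (Finset.sum_nonneg fun i _ => Real.rpow_nonneg (ih _ _ _) _) _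

theorem mixedSum_succ_rpow (m : ℕ) (r : Fin (m + 1) → ℝ) (hr : 0 < r 0) (n : Fin (m + 1) → ℕ)
    (a : (Fin (m + 1) → ℕ) → 𝕜) :
    mixedSum (m + 1) r n a ^ r 0 = ∑ i ∈ Finset.range (n 0),
      mixedSum m (Fin.tail r) (Fin.tail n) (fun v => a (Fin.cons i v)) ^ r 0 := by
  rw [mixedSum, one_div, Real.rpow_inv_rpow
    (Finset.sum_nonneg fun i _ => Real.rpow_nonneg (mixedSum_nonneg _ _ _ _) _) hr.ne']

theorem mixedSum_le_prod_mul_mixedSum (m : ℕ) (r q : Fin m → ℝ) (hr : ∀ j, 0 < r j)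
    (hq : ∀ j, 0 < q j) (n : Fin m → ℕ) (a : (Fin m → ℕ) → 𝕜) :
    mixedSum m r n a ≤
      (∏ k, (n k : ℝ) ^ max (1 / r k - 1 / q k) 0) * mixedSum m q n a := by
  induction m with
  | zero => simp [mixedSum]
  | succ m ih =>
    set P : ℝ := ∏ k, (Fin.tail n k : ℝ) ^ max (1 / Fin.tail r k - 1 / Fin.tail q k) 0 with hP
    have hP0 : 0 ≤ P := Finset.prod_nonneg fun k _ => by positivity
    set M : ℕ → ℝ := fun i =>
      mixedSum m (Fin.tail q) (Fin.tail n) (fun v => a (Fin.cons i v)) with hM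
    have hM0 : ∀ i, 0 ≤ M i := fun i => mixedSum_nonneg _ _ _ _
    have hr0 := hr 0
    calc mixedSum (m + 1) r n a
        ≤ (∑ i ∈ Finset.range (n 0), (P * M i) ^ r 0) ^ (1 / r 0) := by
          refine Real.rpow_le_rpow
            (Finset.sum_nonneg fun i _ => Real.rpow_nonneg (mixedSum_nonneg _ _ _ _) _)
            (Finset.sum_le_sum fun i _ => Real.rpow_le_rpow (mixedSum_nonneg _ _ _ _)
              (ih _ _ (fun j => hr j.succ) (fun j => hq j.succ) _ _) hr0.le) (by positivity)
      _ = P * (∑ i ∈ Finset.range (n 0), M i ^ r 0) ^ (1 / r 0) := by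
          simp only [Real.mul_rpow hP0 (hM0 _)]
          rw [← Finset.mul_sum, Real.mul_rpow (by positivity)
            (Finset.sum_nonneg fun i _ => Real.rpow_nonneg (hM0 _) _), one_div,
            Real.rpow_rpow_inv hP0 hr0.ne']
      _ ≤ P * ((n 0 : ℝ) ^ max (1 / r 0 - 1 / q 0) 0 *
            (∑ i ∈ Finset.range (n 0), M i ^ q 0) ^ (1 / q 0)) :=
          mul_le_mul_of_nonneg_left (rpow_sum_rpow_le_card_rpow_mul _ _ hM0 hr0 (hq 0)) hP0
      _ = _ := by
          rw [Fin.prod_univ_succ, mixedSum]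
          simp only [hP, hM, Fin.tail]
          ring

theorem norm_le_mixedSum (m : ℕ) (r : Fin m → ℝ) (hr : ∀ j, 0 < r j) (n : Fin m → ℕ)
    (a : (Fin m → ℕ) → 𝕜) (v : Fin m → ℕ) (hv : ∀ j, v j < n j) :
    ‖a v‖ ≤ mixedSum m r n a := by
  induction m with
  | zero => rw [mixedSum, Subsingleton.elim v Fin.elim0]
  | succ m ih =>
    have h1 := ih (Fin.tail r) (fun j => hr j.succ) (Fin.tail n)
      (fun w => a (Fin.cons (v 0) w)) (Fin.tail v) (fun j => hv j.succ)
    rw [Fin.cons_self_tail] at h1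
    refine h1.trans ?_
    rw [← Real.rpow_le_rpow_iff (mixedSum_nonneg _ _ _ _) (mixedSum_nonneg _ _ _ _) (hr 0),
      mixedSum_succ_rpow _ _ (hr 0)]
    exact Finset.single_le_sum (f := fun i =>
      mixedSum m (Fin.tail r) (Fin.tail n) (fun v => a (Fin.cons i v)) ^ r 0)
      (fun i _ => Real.rpow_nonneg (mixedSum_nonneg _ _ _ _) _) (Finset.mem_range.2 (hv 0))

/-- If, for every value of the `k`-th index, the array has an entry of modulus at least `1` whose
indices before `k` vanish, then its mixed sum is at least `n_k ^ (1 / r_k)`. -/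
theorem rpow_le_mixedSum (m : ℕ) (r : Fin m → ℝ) (hr : ∀ j, 0 < r j) (n : Fin m → ℕ)
    (a : (Fin m → ℕ) → 𝕜) (k : Fin m)
    (h : ∀ i < n k, ∃ v : Fin m → ℕ, (∀ j, v j < n j) ∧ v k = i ∧ (∀ j < k, v j = 0) ∧
      1 ≤ ‖a v‖) (hn : ∀ j, 0 < n j) :
    (n k : ℝ) ^ (1 / r k) ≤ mixedSum m r n a := by
  induction m with
  | zero => exact k.elim0
  | succ m ih =>
    rw [← Real.rpow_le_rpow_iff (by positivity) (mixedSum_nonneg _ _ _ _) (hr 0),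
      mixedSum_succ_rpow _ _ (hr 0)]
    induction k using Fin.cases with
    | zero =>
      rw [one_div, Real.rpow_inv_rpow (by positivity) (hr 0).ne']
      calc (n 0 : ℝ) = ∑ i ∈ Finset.range (n 0), 1 := by simp
        _ ≤ _ := Finset.sum_le_sum fun i hi => by
          obtain ⟨v, hv, hv0, -, h1⟩ := h i (Finset.mem_range.1 hi)
          refine Real.one_le_rpow (h1.trans ?_) (hr 0).le
          have := norm_le_mixedSum m (Fin.tail r) (fun j => hr j.succ) (Fin.tail n)
            (fun w => a (Fin.cons i w)) (Fin.tail v) (fun j => hv j.succ)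
          rwa [← hv0, Fin.cons_self_tail, hv0] at this
    | succ k =>
      refine (Real.rpow_le_rpow (by positivity) (ih (Fin.tail r) (fun j => hr j.succ) (Fin.tail n)
        (fun w => a (Fin.cons 0 w)) k (fun i hi => ?_) (fun j => hn j.succ)) (hr 0).le).trans
        (Finset.single_le_sum (f := fun i =>
          mixedSum m (Fin.tail r) (Fin.tail n) (fun v => a (Fin.cons i v)) ^ r 0)
          (fun i _ => Real.rpow_nonneg (mixedSum_nonneg _ _ _ _) _)
          (Finset.mem_range.2 (hn 0)))
      obtain ⟨v, hv, hvk, hv0, h1⟩ := h i hi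
      refine ⟨Fin.tail v, fun j => hv j.succ, hvk, fun j hj => hv0 j.succ (by simpa using hj), ?_⟩
      rwa [← hv0 0 (Fin.succ_pos k), Fin.cons_self_tail]

theorem norm_rpow_add_norm_rpow_le (a b : 𝕜) {Q : ℝ} (hQ : 2 ≤ Q) :
    ‖a‖ ^ Q + ‖b‖ ^ Q ≤ (‖a + b‖ ^ Q + ‖a - b‖ ^ Q) / 2 := by
  have hsq : ∀ x : 𝕜, ‖x‖ ^ Q = (‖x‖ ^ 2) ^ (Q / 2) := fun x => by
    rw [← Real.rpow_natCast, ← Real.rpow_mul (norm_nonneg _)]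
    congr 1
    push_cast
    ring
  have hpar : ‖a‖ ^ 2 + ‖b‖ ^ 2 = (‖a + b‖ ^ 2 + ‖a - b‖ ^ 2) / 2 := by
    have := parallelogram_law_with_norm 𝕜 a b
    nlinarith
  have h1 := Real.add_rpow_le_rpow_add (sq_nonneg ‖a‖) (sq_nonneg ‖b‖) (p := Q / 2) (by linarith)
  rw [hsq a, hsq b, hsq (a + b), hsq (a - b)]
  rw [hpar] at h1
  exact h1.trans (midpoint_rpow_le (sq_nonneg _) (sq_nonneg _) (by linarith))

/-- The mixed norms with exponents `q₁ ≥ ⋯ ≥ qₘ ≥ 2` satisfy the two-point cotype `Q` inequality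
with constant `1`, for every `Q ≥ q₁`. -/
theorem mixedSum_rpow_add_le (m : ℕ) (q : Fin m → ℝ) (hq : Antitone q) (hq2 : ∀ j, 2 ≤ q j)
    (n : Fin m → ℕ) {Q : ℝ} (hQ2 : 2 ≤ Q) (hQ : ∀ j, q j ≤ Q) (a b : (Fin m → ℕ) → 𝕜) :
    mixedSum m q n a ^ Q + mixedSum m q n b ^ Q ≤
      (mixedSum m q n (a + b) ^ Q + mixedSum m q n (a - b) ^ Q) / 2 := by
  induction m generalizing Q with
  | zero => exact norm_rpow_add_norm_rpow_le _ _ hQ2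
  | succ m ih =>
    have hq0 : 0 < q 0 := by linarith [hq2 0]
    have key : mixedSum (m + 1) q n a ^ q 0 + mixedSum (m + 1) q n b ^ q 0 ≤
        (mixedSum (m + 1) q n (a + b) ^ q 0 + mixedSum (m + 1) q n (a - b) ^ q 0) / 2 := by
      simp only [mixedSum_succ_rpow _ _ hq0]
      rw [← Finset.sum_add_distrib, ← Finset.sum_add_distrib, Finset.sum_div]
      exact Finset.sum_le_sum fun i _ =>
        ih (Fin.tail q) (fun j k h => hq (Fin.succ_le_succ_iff.2 h)) (fun j => hq2 j.succ) _
          (hq2 0) (fun j => hq (Fin.zero_le _)) _ _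
    have hpow : ∀ c : (Fin (m + 1) → ℕ) → 𝕜, mixedSum (m + 1) q n c ^ Q =
        (mixedSum (m + 1) q n c ^ q 0) ^ (Q / q 0) := fun c => by
      rw [← Real.rpow_mul (mixedSum_nonneg _ _ _ _), mul_div_cancel₀ _ hq0.ne']
    have hnn : ∀ c : (Fin (m + 1) → ℕ) → 𝕜, 0 ≤ mixedSum (m + 1) q n c ^ q 0 :=
      fun c => Real.rpow_nonneg (mixedSum_nonneg _ _ _ _) _
    have h1Q : 1 ≤ Q / q 0 := (one_le_div hq0).2 (hQ 0)
    simp only [hpow]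
    refine (Real.add_rpow_le_rpow_add (hnn a) (hnn b) h1Q).trans
      ((Real.rpow_le_rpow (add_nonneg (hnn a) (hnn b)) key (by linarith)).trans
        (midpoint_rpow_le (hnn _) (hnn _) h1Q))

/-- A two-point cotype inequality yields signs realising the cotype inequality. -/
theorem exists_signs_sum_rpow_le {V : Type*} [AddCommGroup V] [Module 𝕜 V] (N : V → ℝ)
    (hN : ∀ v, 0 ≤ N v) {Q : ℝ}
    (h : ∀ a b, N a ^ Q + N b ^ Q ≤ (N (a + b) ^ Q + N (a - b) ^ Q) / 2) (y : ℕ → V) (n : ℕ) :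
    ∃ ε : ℕ → 𝕜, (∀ i, ‖ε i‖ = 1) ∧
      ∑ i ∈ Finset.range n, N (y i) ^ Q ≤ N (∑ i ∈ Finset.range n, ε i • y i) ^ Q := by
  induction n with
  | zero => exact ⟨fun _ => 1, by simp, by simpa using Real.rpow_nonneg (hN 0) Q⟩
  | succ n ih =>
    obtain ⟨ε, hε, hs⟩ := ih
    have hsum : ∀ c : 𝕜, ∑ i ∈ Finset.range n, Function.update ε n c i • y i =
        ∑ i ∈ Finset.range n, ε i • y i := fun c =>
      Finset.sum_congr rfl fun i hi => by
        rw [Function.update_of_ne (Finset.mem_range.1 hi).ne]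
    have hnorm : ∀ c : 𝕜, ‖c‖ = 1 → ∀ i, ‖Function.update ε n c i‖ = 1 := fun c hc i => by
      by_cases hi : i = n
      · subst hi; simpa using hc
      · simpa [Function.update_of_ne hi] using hε i
    have h2 := h (∑ i ∈ Finset.range n, ε i • y i) (y n)
    rcases le_total (N (∑ i ∈ Finset.range n, ε i • y i + y n) ^ Q)
      (N (∑ i ∈ Finset.range n, ε i • y i - y n) ^ Q) with h3 | h3
    · refine ⟨Function.update ε n (-1), hnorm _ (by simp), ?_⟩
      rw [Finset.sum_range_succ, Finset.sum_range_succ, hsum, Function.update_self, neg_one_smul,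
        ← sub_eq_add_neg]
      linarith
    · refine ⟨Function.update ε n 1, hnorm _ (by simp), ?_⟩
      rw [Finset.sum_range_succ, Finset.sum_range_succ, hsum, Function.update_self, one_smul]
      linarith

theorem exists_signs_sum_mixedSum_rpow_le (m : ℕ) (q : Fin m → ℝ) (hq : Antitone q)
    (hq2 : ∀ j, 2 ≤ q j) (n : Fin m → ℕ) {Q : ℝ} (hQ2 : 2 ≤ Q) (hQ : ∀ j, q j ≤ Q)
    (y : ℕ → (Fin m → ℕ) → 𝕜) (N : ℕ) :
    ∃ ε : ℕ → 𝕜, (∀ i, ‖ε i‖ = 1) ∧ ∑ i ∈ Finset.range N, mixedSum m q n (y i) ^ Q ≤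
      mixedSum m q n (∑ i ∈ Finset.range N, ε i • y i) ^ Q := by
  have h := mixedSum_rpow_add_le (𝕜 := 𝕜) m q hq hq2 n hQ2 hQ
  have h' := exists_signs_sum_rpow_le (𝕜 := 𝕜) (Q := Q) (mixedSum (𝕜 := 𝕜) m q n)
    (mixedSum_nonneg m q n) h
  exact h' y N

/-- Phases aligning scalars. -/
theorem exists_phases_sum_norm_le (y : ℕ → 𝕜) (n : ℕ) :
    ∃ ε : ℕ → 𝕜, (∀ i, ‖ε i‖ = 1) ∧
      ∑ i ∈ Finset.range n, ‖y i‖ ≤ ‖∑ i ∈ Finset.range n, ε i * y i‖ := by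
  have : ∀ z : 𝕜, ∃ e : 𝕜, ‖e‖ = 1 ∧ e * z = (‖z‖ : 𝕜) := fun z => by
    obtain ⟨c, hc, h⟩ := RCLike.exists_norm_eq_mul_self z
    exact ⟨c, hc, h.symm⟩
  choose e he hez using this
  refine ⟨fun i => e (y i), fun i => he _, ?_⟩
  simp only [hez]
  rw [← RCLike.ofReal_sum, RCLike.norm_ofReal]
  exact le_abs_self _

end MixedSum


section LpForm

variable {𝕜 : Type*} [RCLike 𝕜]

theorem LpForm.coeff_cons {m : ℕ} {p : Fin (m + 1) → ℝ≥0∞} [∀ j, Fact (1 ≤ p j)]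
    (T : LpForm 𝕜 p) (i : ℕ) (v : Fin m → ℕ) :
    T.coeff (Fin.cons i v) =
      LpForm.coeff (p := fun j : Fin m => p j.succ) (T.curryLeft (lp.single (p 0) i 1)) v := by
  rw [LpForm.coeff, LpForm.coeff, ContinuousMultilinearMap.curryLeft_apply]
  congr 1
  funext j
  induction j using Fin.cases <;> rfl

theorem lp.norm_sum_single_le {p : ℝ≥0∞} [Fact (1 ≤ p)] (c : ℕ → 𝕜) (d : ℕ → ℝ)
    (n : ℕ) (hd : ∀ i, 0 ≤ d i) (hc : ∀ i, ‖c i‖ = d i ^ (1 / p.toReal)) :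
    ‖∑ i ∈ Finset.range n, lp.single (E := fun _ : ℕ => 𝕜) p i (c i)‖ ≤
      (∑ i ∈ Finset.range n, d i) ^ (1 / p.toReal) := by
  have hp1 : 1 ≤ p := Fact.out
  have hS : 0 ≤ ∑ i ∈ Finset.range n, d i := Finset.sum_nonneg fun i _ => hd i
  rcases eq_or_ne p ∞ with rfl | hp
  · simp only [ENNReal.toReal_top, div_zero, Real.rpow_zero] at hc ⊢
    refine lp.norm_le_of_forall_le zero_le_one fun i => ?_
    rw [lp.coeFn_sum, Finset.sum_apply]
    simp only [lp.single_apply, Pi.single_apply]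
    rw [Finset.sum_ite_eq]
    split_ifs
    · exact (hc i).le
    · simp
  · have hp0 : 0 < p.toReal := ENNReal.toReal_pos (by positivity) hp
    rw [← Real.rpow_le_rpow_iff (norm_nonneg _) (Real.rpow_nonneg hS _) hp0,
      lp.norm_sum_single hp0, ← Real.rpow_mul hS, one_div_mul_cancel hp0.ne', Real.rpow_one]
    refine Finset.sum_le_sum fun i _ => ?_
    rw [hc, ← Real.rpow_mul (hd i), one_div_mul_cancel hp0.ne', Real.rpow_one]

/-- The inductive step of the mixed Hardy–Littlewood inequality. -/
theorem LpForm.mixedSum_coeff_le_step {m : ℕ} {p : Fin (m + 1) → ℝ≥0∞} [∀ j, Fact (1 ≤ p j)]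
    (q : Fin (m + 1) → ℝ) (n : Fin (m + 1) → ℕ) {Q : ℝ} (hQ : 0 < Q) (hq : 0 < q 0)
    (hqQ : 1 / q 0 = 1 / Q - 1 / (p 0).toReal)
    (hcot : ∀ y : ℕ → (Fin m → ℕ) → 𝕜, ∃ ε : ℕ → 𝕜, (∀ i, ‖ε i‖ = 1) ∧
      ∑ i ∈ Finset.range (n 0), mixedSum m (Fin.tail q) (Fin.tail n) (y i) ^ Q ≤
        mixedSum m (Fin.tail q) (Fin.tail n) (∑ i ∈ Finset.range (n 0), ε i • y i) ^ Q)
    (hsmul : ∀ (c : ℝ) (y : (Fin m → ℕ) → 𝕜), 0 ≤ c →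
      mixedSum m (Fin.tail q) (Fin.tail n) ((c : 𝕜) • y) =
        c * mixedSum m (Fin.tail q) (Fin.tail n) y)
    (hle : ∀ S : LpForm 𝕜 (fun j : Fin m => p j.succ),
      mixedSum m (Fin.tail q) (Fin.tail n) S.coeff ≤ ‖S‖)
    (T : LpForm 𝕜 p) : mixedSum (m + 1) q n T.coeff ≤ ‖T‖ := by
  set N : ((Fin m → ℕ) → 𝕜) → ℝ := mixedSum m (Fin.tail q) (Fin.tail n) with hN
  set S : ℕ → LpForm 𝕜 (fun j : Fin m => p j.succ) :=
    fun i => T.curryLeft (lp.single (p 0) i 1) with hS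
  have hcoef : ∀ i, (fun v => T.coeff (Fin.cons i v)) = (S i).coeff :=
    fun i => funext fun v => T.coeff_cons i v
  set c : ℕ → ℝ := fun i => N (S i).coeff with hc
  have hc0 : ∀ i, 0 ≤ c i := fun i => mixedSum_nonneg _ _ _ _
  set d : ℕ → ℝ := fun i => c i ^ q 0 with hd
  have hd0 : ∀ i, 0 ≤ d i := fun i => Real.rpow_nonneg (hc0 i) _
  set x : ℕ → ℝ := fun i => d i ^ (1 / (p 0).toReal) with hx
  have hx0 : ∀ i, 0 ≤ x i := fun i => Real.rpow_nonneg (hd0 i) _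
  set A : ℝ := ∑ i ∈ Finset.range (n 0), d i with hA
  have hA0 : 0 ≤ A := Finset.sum_nonneg fun i _ => hd0 i
  have hmain : mixedSum (m + 1) q n T.coeff = A ^ (1 / q 0) := by
    rw [mixedSum]
    simp only [hcoef]
    rfl
  obtain ⟨ε, hε, hsum⟩ := hcot fun i => (x i : 𝕜) • (S i).coeff
  set u : lp (fun _ : ℕ => 𝕜) (p 0) :=
    ∑ i ∈ Finset.range (n 0), lp.single (p 0) i (ε i * (x i : 𝕜)) with hu
  have hu_norm : ‖u‖ ≤ A ^ (1 / (p 0).toReal) := by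
    refine lp.norm_sum_single_le _ _ _ hd0 fun i => ?_
    rw [norm_mul, hε, one_mul, RCLike.norm_ofReal, abs_of_nonneg (hx0 i)]
  have hcomb : ∑ i ∈ Finset.range (n 0), ε i • (x i : 𝕜) • (S i).coeff =
      LpForm.coeff (p := fun j : Fin m => p j.succ) (T.curryLeft u) := by
    have hsing : ∀ i, lp.single (E := fun _ : ℕ => 𝕜) (p 0) i (ε i * (x i : 𝕜)) =
        (ε i * (x i : 𝕜)) • lp.single (E := fun _ : ℕ => 𝕜) (p 0) i 1 := fun i => by
      rw [← lp.single_smul, smul_eq_mul, mul_one]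
    funext v
    rw [hu, map_sum]
    simp only [hsing, map_smul]
    simp only [Finset.sum_apply, Pi.smul_apply, smul_eq_mul, LpForm.coeff, hS, mul_assoc,
      _root_.sum_apply, _root_.smul_apply]
  have hterm : ∀ i, N ((x i : 𝕜) • (S i).coeff) ^ Q = d i := fun i => by
    rw [hsmul _ _ (hx0 i)]
    change (x i * c i) ^ Q = _
    rcases (hc0 i).eq_or_lt with h0 | h0
    · rw [hd]; simp only [← h0, mul_zero, Real.zero_rpow hQ.ne', Real.zero_rpow hq.ne']
    · rw [hx, hd]
      simp only
      rw [← Real.rpow_mul h0.le]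
      nth_rewrite 2 [← Real.rpow_one (c i)]
      rw [← Real.rpow_add h0, ← Real.rpow_mul h0.le]
      congr 1
      have h1 : 1 / (p 0).toReal = 1 / Q - 1 / q 0 := by linarith
      rw [h1]
      field_simp
      ring
  have hAle : A ≤ (‖T‖ * A ^ (1 / (p 0).toReal)) ^ Q := by
    simp only [hterm] at hsum
    refine hsum.trans (Real.rpow_le_rpow (mixedSum_nonneg _ _ _ _) ?_ hQ.le)
    rw [hcomb]
    refine (hle _).trans ((T.curryLeft.le_opNorm u).trans ?_)
    rw [ContinuousMultilinearMap.curryLeft_norm]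
    exact mul_le_mul_of_nonneg_left hu_norm (norm_nonneg _)
  rw [hmain]
  rcases hA0.eq_or_lt with h0 | h0
  · rw [← h0, Real.zero_rpow (by positivity)]
    exact norm_nonneg _
  · have h1 := Real.rpow_le_rpow hA0 hAle (one_div_nonneg.2 hQ.le)
    rw [one_div Q, Real.rpow_rpow_inv (by positivity) hQ.ne'] at h1
    rw [hqQ, Real.rpow_sub h0, one_div Q]
    exact (div_le_iff₀ (by positivity)).2 h1

theorem mixedSum_smul (m : ℕ) (r : Fin m → ℝ) (hr : ∀ j, 0 < r j) (n : Fin m → ℕ) (c : ℝ)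
    (a : (Fin m → ℕ) → 𝕜) (hc : 0 ≤ c) :
    mixedSum m r n ((c : 𝕜) • a) = c * mixedSum m r n a := by
  induction m with
  | zero => simp [mixedSum, abs_of_nonneg hc]
  | succ m ih =>
    have h : ∀ i : ℕ, (fun v => ((c : 𝕜) • a) (Fin.cons i v)) =
        (c : 𝕜) • fun v => a (Fin.cons i v) := fun i => rfl
    simp only [mixedSum, h]
    simp only [ih (Fin.tail r) (fun j => hr j.succ)]
    simp only [Real.mul_rpow hc (mixedSum_nonneg _ _ _ _)]
    rw [← Finset.mul_sum, Real.mul_rpow (by positivity)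
      (Finset.sum_nonneg fun i _ => Real.rpow_nonneg (mixedSum_nonneg _ _ _ _) _), one_div,
      Real.rpow_rpow_inv hc (hr 0).ne']

end LpForm

section Exponents

theorem hlDelta_succ {m : ℕ} (p : Fin (m + 1) → ℝ≥0∞) (k : Fin m) :
    hlDelta p k.succ = hlDelta (fun j : Fin m => p j.succ) k := by
  rw [hlDelta, hlDelta, ← Fin.map_succEmb_Ici, Finset.sum_map]
  rfl

theorem one_div_hlDelta {m : ℕ} (p : Fin m → ℝ≥0∞) (k : Fin m) :
    1 / hlDelta p k = 1 - ∑ j ∈ Finset.Ici k, 1 / (p j).toReal := one_div_one_div _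

theorem hlDelta_pos {m : ℕ} (p : Fin m → ℝ≥0∞) (hp : ∑ j, 1 / (p j).toReal < 1) (k : Fin m) :
    0 < hlDelta p k := by
  have : ∑ j ∈ Finset.Ici k, 1 / (p j).toReal ≤ ∑ j, 1 / (p j).toReal :=
    Finset.sum_le_sum_of_subset_of_nonneg (Finset.subset_univ _) fun j _ _ => by positivity
  exact one_div_pos.2 (by linarith)

theorem antitone_hlDelta {m : ℕ} (p : Fin m → ℝ≥0∞) (hp : ∑ j, 1 / (p j).toReal < 1) :
    Antitone (hlDelta p) := fun j k hjk => by
  refine (one_div_le_one_div (hlDelta_pos p hp j) (hlDelta_pos p hp k)).1 ?_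
  rw [one_div_hlDelta, one_div_hlDelta]
  have : ∑ i ∈ Finset.Ici k, 1 / (p i).toReal ≤ ∑ i ∈ Finset.Ici j, 1 / (p i).toReal :=
    Finset.sum_le_sum_of_subset_of_nonneg (Finset.Ici_subset_Ici.2 hjk) fun j _ _ => by positivity
  linarith

theorem two_le_hlDelta {m : ℕ} (p : Fin (m + 1) → ℝ≥0∞) [∀ j, Fact (1 ≤ p j)]
    (hp : ∑ j, 1 / (p j).toReal < 1) (hlast : p (Fin.last m) ≤ 2) (k : Fin (m + 1)) :
    2 ≤ hlDelta p k := by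
  refine le_trans ?_ (antitone_hlDelta p hp (Fin.le_last k))
  have hpos := hlDelta_pos p hp (Fin.last m)
  have h1 := one_div_hlDelta p (Fin.last m)
  rw [← Fin.top_eq_last, Finset.Ici_top, Finset.sum_singleton, Fin.top_eq_last] at h1
  have h1p : 1 ≤ p (Fin.last m) := Fact.out
  have h2 : (p (Fin.last m)).toReal ≤ 2 := by
    simpa using ENNReal.toReal_mono (by simp) hlast
  have h0 : 0 < (p (Fin.last m)).toReal :=
    ENNReal.toReal_pos (by positivity) (ne_top_of_le_ne_top (by simp) hlast)
  have h3 : 1 / 2 ≤ 1 / (p (Fin.last m)).toReal := one_div_le_one_div_of_le h0 h2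
  exact (one_div_le_one_div hpos two_pos).1 (by linarith)

end Exponents

/-- The mixed Hardy–Littlewood inequality with the exponents `hlDelta p` and constant `1`. -/
theorem LpForm.mixedSum_hlDelta_coeff_le {𝕜 : Type*} [RCLike 𝕜] (m : ℕ)
    (p : Fin (m + 1) → ℝ≥0∞) [∀ j, Fact (1 ≤ p j)] (hp : ∑ j, 1 / (p j).toReal < 1)
    (hlast : p (Fin.last m) ≤ 2) (n : Fin (m + 1) → ℕ) (T : LpForm 𝕜 p) :
    mixedSum (m + 1) (hlDelta p) n T.coeff ≤ ‖T‖ := by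
  induction m with
  | zero =>
    refine LpForm.mixedSum_coeff_le_step (hlDelta p) n one_pos (hlDelta_pos p hp 0) ?_
      (fun y => ?_) (fun c y hc => mixedSum_smul _ _ (fun j => j.elim0) _ _ _ hc) (fun S => ?_) T
    · rw [one_div_hlDelta]
      have : Finset.Ici (0 : Fin 1) = {0} := rfl
      rw [this, Finset.sum_singleton, div_one]
    · obtain ⟨ε, hε, h⟩ := exists_phases_sum_norm_le (fun i => y i Fin.elim0) (n 0)
      exact ⟨ε, hε, by simpa [mixedSum] using h⟩
    · refine (S.le_opNorm fun j => lp.single (p j.succ) (Fin.elim0 j) (1 : 𝕜)).trans_eq ?_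
      rw [Finset.univ_eq_empty, Finset.prod_empty, mul_one]
  | succ m ih =>
    have htail : Fin.tail (hlDelta p) = hlDelta (fun j : Fin (m + 1) => p j.succ) :=
      funext fun k => hlDelta_succ p k
    have hp' : ∑ j : Fin (m + 1), 1 / (p j.succ).toReal < 1 := by
      rw [Fin.sum_univ_succ] at hp
      have : 0 ≤ 1 / (p 0).toReal := by positivity
      linarith
    have hpos := fun k => hlDelta_pos (fun j : Fin (m + 1) => p j.succ) hp' k
    have hanti := antitone_hlDelta (fun j : Fin (m + 1) => p j.succ) hp'
    have htwo := two_le_hlDelta (fun j : Fin (m + 1) => p j.succ) hp' hlast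
    have hIci : ∀ l, Finset.Ici (0 : Fin (l + 1)) = Finset.univ := fun l =>
      Finset.eq_univ_iff_forall.2 fun j => Finset.mem_Ici.2 (Fin.zero_le j)
    refine LpForm.mixedSum_coeff_le_step (hlDelta p) n
      (hlDelta_pos (fun j : Fin (m + 1) => p j.succ) hp' 0) (hlDelta_pos p hp 0) ?_
      (fun y => ?_) (fun c y hc => ?_) (fun S => ?_) T
    · rw [one_div_hlDelta, one_div_hlDelta, hIci, hIci, Fin.sum_univ_succ]
      ring
    · rw [htail]
      exact exists_signs_sum_mixedSum_rpow_le _ _ hanti htwo _ (htwo 0)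
        (fun j => hanti (Fin.zero_le j)) y (n 0)
    · rw [htail]
      exact mixedSum_smul _ _ hpos _ _ _ hc
    · rw [htail]
      exact ih (fun j => p j.succ) hp' hlast _ S

section Optimality

/-- A weighted form of Hölder's inequality for products of finitely many sequences. -/
theorem sum_prod_rpow_le_card_rpow {ι : Type*} (s : Finset ι) (n : ℕ) (hn : 0 < n) (w : ι → ℝ)
    (hw : ∀ j ∈ s, 0 ≤ w j) {w₀ : ℝ} (hw₀ : 0 ≤ w₀) (hsum : w₀ + ∑ j ∈ s, w j = 1)
    (f : ι → ℕ → ℝ) (hf : ∀ j i, 0 ≤ f j i)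
    (hfs : ∀ j ∈ s, w j * ∑ i ∈ Finset.range n, f j i ≤ w j) :
    ∑ i ∈ Finset.range n, ∏ j ∈ s, f j i ^ w j ≤ (n : ℝ) ^ w₀ := by
  have hn' : (0 : ℝ) < n := Nat.cast_pos.2 hn
  have hpt : ∀ i, ∏ j ∈ s, f j i ^ w j ≤ (n : ℝ) ^ w₀ * (w₀ / n + ∑ j ∈ s, w j * f j i) := by
    intro i
    have h := Real.geom_mean_le_arith_mean_weighted (Finset.insertNone s)
      (fun o => o.elim w₀ w) (fun o => o.elim (1 / (n : ℝ)) fun j => f j i)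
      (by
        rintro (_ | j) hj
        · exact hw₀
        · exact hw j (by simpa using hj))
      (by simpa using hsum)
      (by
        rintro (_ | j) _
        · simp
        · exact hf j i)
    rw [Finset.prod_insertNone, Finset.sum_insertNone] at h
    simp only [Option.elim] at h
    calc ∏ j ∈ s, f j i ^ w j
        = (n : ℝ) ^ w₀ * ((1 / (n : ℝ)) ^ w₀ * ∏ j ∈ s, f j i ^ w j) := by
          rw [← mul_assoc, ← Real.mul_rpow hn'.le (by positivity), mul_one_div_cancel hn'.ne',
            Real.one_rpow, one_mul]
      _ ≤ _ := by
          rw [← mul_one_div w₀]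
          exact mul_le_mul_of_nonneg_left h (by positivity)
  refine (Finset.sum_le_sum fun i _ => hpt i).trans ?_
  rw [← Finset.mul_sum]
  refine mul_le_of_le_one_right (by positivity) ?_
  rw [Finset.sum_add_distrib, Finset.sum_comm, Finset.sum_const, Finset.card_range, nsmul_eq_mul,
    mul_div_cancel₀ _ hn'.ne', ← hsum]
  simp only [← Finset.mul_sum]
  gcongr with j hj
  exact hfs j hj

variable {𝕜 : Type*} [RCLike 𝕜] {m : ℕ} (p : Fin m → ℝ≥0∞) [∀ j, Fact (1 ≤ p j)]

/-- The form `(x₁, …, xₘ) ↦ ∑_{l < N} ∏_{j < k} x_j(0) ∏_{j ≥ k} x_j(l)`. -/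
noncomputable def diagForm (𝕜 : Type*) [RCLike 𝕜] (k : Fin m) (N : ℕ) : LpForm 𝕜 p :=
  ∑ l ∈ Finset.range N, (ContinuousMultilinearMap.mkPiAlgebra 𝕜 (Fin m) 𝕜).compContinuousLinearMap
    fun j => lp.evalCLM 𝕜 (fun _ : ℕ => 𝕜) (p j) (if j < k then 0 else l)

theorem diagForm_apply (k : Fin m) (N : ℕ) (x : ∀ j, lp (fun _ : ℕ => 𝕜) (p j)) :
    diagForm p 𝕜 k N x = ∑ l ∈ Finset.range N, ∏ j, x j (if j < k then 0 else l) := by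
  simp only [diagForm, _root_.sum_apply]
  rfl

theorem norm_diagForm_le (k : Fin m) (N : ℕ) (hN : 0 < N) (hp : ∑ j, 1 / (p j).toReal < 1) :
    ‖diagForm p 𝕜 k N‖ ≤ (N : ℝ) ^ (1 / hlDelta p k) := by
  have hp0 : ∀ j, p j ≠ 0 := fun j => (one_pos.trans_le (Fact.out : 1 ≤ p j)).ne'
  refine ContinuousMultilinearMap.opNorm_le_bound (by positivity) fun x => ?_
  have hle : ∀ j i, ‖x j i‖ ≤ ‖x j‖ := fun j i => lp.norm_apply_le_norm (hp0 j) (x j) i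
  set f : Fin m → ℕ → ℝ := fun j i => (‖x j i‖ / ‖x j‖) ^ (p j).toReal with hf
  have hf0 : ∀ j i, 0 ≤ f j i := fun j i => by positivity
  have hbound : ∀ j i, ‖x j i‖ ≤ ‖x j‖ * f j i ^ (1 / (p j).toReal) := fun j i => by
    rcases (norm_nonneg (x j)).eq_or_lt with h0 | h0
    · simpa [← h0] using hle j i
    · rcases eq_or_ne (p j) ∞ with hj | hj
      · simpa [hf, hj] using hle j i
      · have hpj := ENNReal.toReal_pos (hp0 j) hj
        rw [hf]
        simp only
        rw [one_div, Real.rpow_rpow_inv (by positivity) hpj.ne', mul_div_cancel₀ _ h0.ne']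
  have hfs : ∀ j ∈ Finset.Ici k,
      1 / (p j).toReal * ∑ i ∈ Finset.range N, f j i ≤ 1 / (p j).toReal := fun j _ => by
    rcases eq_or_ne (p j) ∞ with hj | hj
    · simp [hj]
    · have hpj := ENNReal.toReal_pos (hp0 j) hj
      refine mul_le_of_le_one_right (by positivity) ?_
      simp only [hf, Real.div_rpow (norm_nonneg _) (norm_nonneg _)]
      rw [← Finset.sum_div]
      exact div_le_one_of_le₀ (lp.sum_rpow_le_norm_rpow hpj (x j) _) (by positivity)
  have hhold := sum_prod_rpow_le_card_rpow (Finset.Ici k) N hN (fun j => 1 / (p j).toReal)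
    (fun j _ => by positivity) (one_div_nonneg.2 (hlDelta_pos p hp k).le)
    (by rw [one_div_hlDelta]; ring) f hf0 hfs
  have hsplit : ∀ g : Fin m → ℝ, ∏ j, g j = (∏ j ∈ Finset.Iio k, g j) * ∏ j ∈ Finset.Ici k, g j := by
    intro g
    rw [← Finset.prod_union]
    · congr 1
      ext j
      simp [lt_or_ge]
    · rw [Finset.disjoint_left]
      intro j h1 h2
      exact absurd (Finset.mem_Iio.1 h1) (not_lt.2 (Finset.mem_Ici.1 h2))
  rw [diagForm_apply]
  calc ‖∑ l ∈ Finset.range N, ∏ j, x j (if j < k then 0 else l)‖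
      ≤ ∑ l ∈ Finset.range N, ∏ j, ‖x j (if j < k then 0 else l)‖ :=
        norm_sum_le_of_le _ fun l _ => (norm_prod _ _).le
    _ ≤ ∑ l ∈ Finset.range N, (∏ j, ‖x j‖) *
          ∏ j ∈ Finset.Ici k, f j l ^ (1 / (p j).toReal) := by
        refine Finset.sum_le_sum fun l _ => ?_
        rw [hsplit, hsplit, mul_assoc, ← Finset.prod_mul_distrib]
        refine mul_le_mul (Finset.prod_le_prod (fun _ _ => norm_nonneg _) fun j _ => hle j _)
          (Finset.prod_le_prod (fun _ _ => norm_nonneg _) fun j hj => ?_)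
          (by positivity) (by positivity)
        rw [if_neg (not_lt.2 (Finset.mem_Ici.1 hj))]
        exact hbound j l
    _ ≤ (N : ℝ) ^ (1 / hlDelta p k) * ∏ j, ‖x j‖ := by
        rw [← Finset.mul_sum, mul_comm]
        exact mul_le_mul_of_nonneg_right hhold (by positivity)

theorem coeff_diagForm (k : Fin m) (N i : ℕ) (hi : i < N) :
    (diagForm p 𝕜 k N).coeff (fun j => if j < k then 0 else i) = 1 := by
  rw [LpForm.coeff, diagForm_apply, Finset.sum_eq_single i]
  · simp
  · intro l _ hl
    refine Finset.prod_eq_zero (Finset.mem_univ k) ?_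
    simp [lp.single_apply, hl]
  · intro h
    exact absurd (Finset.mem_range.2 hi) h

/-- An inequality between powers of all positive integers compares the exponents. -/
theorem le_of_forall_rpow_le {a b C : ℝ}
    (h : ∀ N : ℕ, 0 < N → (N : ℝ) ^ a ≤ C * (N : ℝ) ^ b) : a ≤ b := by
  by_contra! hab
  have ht := (tendsto_rpow_atTop (sub_pos.2 hab)).comp tendsto_natCast_atTop_atTop
  obtain ⟨N, hN0, hN⟩ := ((Filter.eventually_gt_atTop 0).and (ht.eventually_gt_atTop C)).exists
  have hN' : (0 : ℝ) < N := Nat.cast_pos.2 hN0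
  have h1 := h N hN0
  simp only [Function.comp, Real.rpow_sub hN'] at hN
  rw [lt_div_iff₀ (by positivity)] at hN
  linarith

theorem isOptimalExponent_of_hlDelta_le (r : Fin m → ℝ) (hr : ∀ j, 0 < r j)
    (hp : ∑ j, 1 / (p j).toReal < 1) (k : Fin m) (hk : ∀ j, k < j → hlDelta p j ≤ r j) :
    IsOptimalExponent 𝕜 p r k := by
  intro t C ht hC
  have htz : ∀ j, k < j → t j = 0 := fun j hj => by
    rw [ht j hj, hlExponent, max_eq_right]
    have := one_div_le_one_div_of_le (hlDelta_pos p hp j) (hk j hj)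
    linarith
  have hprod : ∀ N : ℕ, ∏ j, ((if j < k then 1 else N : ℕ) : ℝ) ^ t j = (N : ℝ) ^ t k := by
    intro N
    rw [Finset.prod_eq_single k]
    · simp
    · intro j _ hj
      rcases lt_or_gt_of_ne hj with h | h
      · simp [h]
      · simp [htz j h]
    · simp
  have hC0 : 0 ≤ C := by
    by_contra! hneg
    have h1 := hC (fun _ => 1) (fun _ => one_pos) (diagForm p 𝕜 k 1)
    have h2 := norm_le_mixedSum m r hr (fun _ => 1) (diagForm p 𝕜 k 1).coeff _
      (fun j => (by simp : (if j < k then 0 else 0) < 1))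
    rw [coeff_diagForm p k 1 0 one_pos, norm_one] at h2
    simp only [Nat.cast_one, Real.one_rpow, Finset.prod_const_one, mul_one] at h1
    nlinarith [norm_nonneg (diagForm p 𝕜 k 1)]
  have hbound : ∀ N M : ℕ, 0 < N → 0 < M →
      mixedSum m r (fun j => if j < k then 1 else N) (diagForm p 𝕜 k M).coeff ≤
        C * (M : ℝ) ^ (1 / hlDelta p k) * (N : ℝ) ^ t k := fun N M hN hM => by
    refine (hC (fun j => if j < k then 1 else N) (fun j => by split_ifs <;> omega)
      (diagForm p 𝕜 k M)).trans ?_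
    rw [hprod]
    gcongr
    exact norm_diagForm_le p k M hM hp
  refine max_le (le_of_forall_rpow_le (C := C) fun N hN => ?_)
    (le_of_forall_rpow_le (C := C) fun N hN => ?_)
  · have hN' : (0 : ℝ) < N := Nat.cast_pos.2 hN
    have h1 := rpow_le_mixedSum m r hr (fun j => if j < k then 1 else N)
      (diagForm p 𝕜 k N).coeff k (fun i hi => ?_) (fun j => by split_ifs <;> omega)
    · simp only [lt_irrefl, if_false] at h1
      rw [Real.rpow_sub hN', div_le_iff₀ (by positivity)]
      linarith [hbound N N hN hN]
    · simp only [lt_irrefl, if_false] at hi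
      refine ⟨fun j => if j < k then 0 else i, fun j => ?_, by simp, fun j hj => by simp [hj], ?_⟩
      · dsimp only
        split_ifs <;> omega
      · rw [coeff_diagForm p k N i hi, norm_one]
  · have h1 := norm_le_mixedSum m r hr (fun j => if j < k then 1 else N)
      (diagForm p 𝕜 k 1).coeff (fun j => if j < k then 0 else 0)
      (fun j => by split_ifs <;> omega)
    rw [coeff_diagForm p k 1 0 one_pos, norm_one] at h1
    simpa using h1.trans (hbound N 1 hN one_pos)

end Optimality

theorem mainTheorem3 (𝕜 : Type*) [RCLike 𝕜] (m : ℕ) (hm : 2 ≤ m)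
    (r : Fin m → ℝ) (hr : ∀ j, 0 < r j)
    (p : Fin m → ℝ≥0∞) [∀ j, Fact (1 ≤ p j)]
    (hp_last : ∀ j : Fin m, (j : ℕ) + 1 = m → 1 < p j ∧ p j ≤ 2)
    (hp_init : ∀ j : Fin m, (j : ℕ) + 1 < m → 2 < p j)
    (hp_sum : ∑ j, 1 / (p j).toReal < 1) :
    (∃ D : ℝ, 1 ≤ D ∧ MixedInequality 𝕜 p r (hlExponent p r) D) ∧
    (∀ k : Fin m, (k : ℕ) + 1 = m → IsOptimalExponent 𝕜 p r k) ∧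
    (∀ k : Fin m, (k : ℕ) + 1 < m → (∀ j, k < j → hlDelta p j ≤ r j) →
      IsOptimalExponent 𝕜 p r k) := by
  refine ⟨⟨1, le_rfl, fun n _ T => ?_⟩, fun k hk => ?_, fun k _ hk =>
    isOptimalExponent_of_hlDelta_le p r hr hp_sum k hk⟩
  · obtain ⟨m, rfl⟩ : ∃ l, m = l + 1 := ⟨m - 1, by omega⟩
    refine (mixedSum_le_prod_mul_mixedSum _ r (hlDelta p) hr (hlDelta_pos p hp_sum) n _).trans ?_
    rw [one_mul, mul_comm]
    exact mul_le_mul_of_nonneg_right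
      (LpForm.mixedSum_hlDelta_coeff_le m p hp_sum (hp_last (Fin.last m) rfl).2 n T)
      (Finset.prod_nonneg fun _ _ => by positivity)
  · exact isOptimalExponent_of_hlDelta_le p r hr hp_sum k fun j hj => by omega
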